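/- Let $n\ge 0$ and let $S_n$ be the group of permutations of $\{1,\dots,n\}$. Write $(i\,\ell)$ for the transposition exchanging $i$ and $\ell$, so that $(i\,\ell)u$ is obtained from $u=(u(1),\dots,u(n))$ by swapping the values $i$ and $\ell$. The length of a permutation is the minimal number of factors in an expression of it as a product of simple transpositions $(i\,\,i+1)$. The strong Bruhat order $\preceq$ on $S_n$ is the reflexive and transitive closure of the relation: $v=(i\,j)u$ for some $i<j$, and the length of $v$ is one more than the length of $u$. For $w\in S_n$ the Bruhat interval polytope $\mathsf Q_{e,w}\subset\mathbb R^n$ is the convex hull of the points $(z(1),\dots,z(n))$ with $z\in S_n$ and $e\preceq z\preceq w$, where $e$ is the identity. Let $w\in S_n$ be a Grassmannian permutation, i.e. there is at most one position $k$ with $1\le k<n$ and $w(k)>w(k+1)$. Let $u,v\in S_n$ lie in the interval $[e,w]$ of the strong Bruhat order. Then there is an edge of $\mathsf Q_{e,w}$ between the vertices $(u(1),\dots,u(n))$ and $(v(1),\dots,v(n))$ if and only if there exist $1\le i<\ell\le n$ such that $v=(i\,\ell)u$ and each of the values $j=i+1,i+2,\dots,\ell-1$ occupies in both $u$ and $v$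 the same position as in $w$, i.e. $u^{-1}(j)=v^{-1}(j)=w^{-1}(j)$. Here an edge between $x$ and $y$ means that $x\ne y$ are vertices of the polytope and the segment joining them is a face of it. -/

import Mathlib

namespace BruhatPolytope

/-- `s` is a simple transposition, exchanging two consecutive letters. -/
def IsSimpleTransposition {n : ℕ} (s : Equiv.Perm (Fin n)) : Prop :=
  ∃ i j : Fin n, (j : ℕ) = (i : ℕ) + 1 ∧ s = Equiv.swap i j

/-- The length of `w`: the minimal number of factors in an expression of `w` as a product of
simple transpositions. -/
noncomputable def length {n : ℕ} (w : Equiv.Perm (Fin n)) : ℕ :=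
  sInf {k : ℕ | ∃ L : List (Equiv.Perm (Fin n)),
    (∀ s ∈ L, IsSimpleTransposition s) ∧ L.prod = w ∧ L.length = k}

/-- The cover relation of the strong Bruhat order: `v = (i j) u` with `i < j`, and the length
goes up by exactly one. -/
def BruhatCover {n : ℕ} (u v : Equiv.Perm (Fin n)) : Prop :=
  (∃ i j : Fin n, i < j ∧ Equiv.swap i j * u = v) ∧ length v = length u + 1

/-- The strong Bruhat order, as the reflexive transitive closure of its cover relation. -/
def BruhatLE {n : ℕ} (u v : Equiv.Perm (Fin n)) : Prop :=
  Relation.ReflTransGen BruhatCover u v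

/-- The interval `[u, v]` of the strong Bruhat order. -/
def bruhatInterval {n : ℕ} (u v : Equiv.Perm (Fin n)) : Set (Equiv.Perm (Fin n)) :=
  {z | BruhatLE u z ∧ BruhatLE z v}

/-- The point `(z(1), …, z(n))` of `ℝⁿ`. Letters and positions are indexed by `Fin n`, that is,
from `0`, so one is added to each entry. -/
def permPoint {n : ℕ} (z : Equiv.Perm (Fin n)) : Fin n → ℝ :=
  fun k => ((z k : ℕ) : ℝ) + 1

/-- The Bruhat interval polytope `Q_{u,v}`. -/
def bruhatIntervalPolytope {n : ℕ} (u v : Equiv.Perm (Fin n)) : Set (Fin n → ℝ) :=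
  convexHull ℝ (permPoint '' bruhatInterval u v)

/-- There is an edge of `P` between `x` and `y`: these are two distinct vertices of `P` and the
segment joining them is a face of `P`, i.e. the set of maximizers over `P` of a linear
functional. -/
def IsEdgeBetween {n : ℕ} (P : Set (Fin n → ℝ)) (x y : Fin n → ℝ) : Prop :=
  x ∈ P.extremePoints ℝ ∧ y ∈ P.extremePoints ℝ ∧ x ≠ y ∧ IsExposed ℝ P (segment ℝ x y)

/-- The descents of `w`: the positions `i` (not the last one) with `w(i) > w(i+1)`. -/
def descents {n : ℕ} (w : Equiv.Perm (Fin n)) : Set (Fin n) :=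
  {i | ∃ j : Fin n, (j : ℕ) = (i : ℕ) + 1 ∧ w j < w i}

/-- A Grassmannian permutation: at most one descent. -/
def IsGrassmannian {n : ℕ} (w : Equiv.Perm (Fin n)) : Prop :=
  (descents w).ncard ≤ 1

end BruhatPolytope

/-! Call the values of `w` labels, and replace `z` by `x = z * w⁻¹`, so that `x b` is the entry of
`z` where `w` has `b`. Let `A` be the set of labels standing at or before the descent. Since `w`
increases on both sides of the cut, `z ≼ w` holds exactly when `x` raises no label in `A` and lowers
none outside it (`mem_bruhatInterval_iff`); so the interval becomes a set of restricted
permutations, `boardPerms A`.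

On a board, local optimality implies global optimality. Call an exchange of `x a < x b` tight if it
stays on the board and `x` fixes all values strictly between. If `y` lies on the board, a label
rising across a cut on the way from `x` to `y` and a label falling across it are joined by a chain
of tight exchanges (`transGen_tight`). Summing over cuts, a functional `∑ c b * x b` with `c`
increasing along tight exchanges is maximal at `x` (`sum_mul_le_of_tight`).

Hence every edge at `x` is a tight exchange: otherwise its functional would have `x` as its only
maximizer. Conversely, for each tight exchange there is a `c` constant along it and strictly
increasing along all others (`Tight.exists_functional`), which exposes the segment. The fixed values
of `x` are the values occupying the same position in `u` as in `w`. -/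

namespace BruhatPolytope

open Equiv Finset

variable {n : ℕ}

/-! ### Length as the number of inversions; Bruhat covers -/

/-- The inversions of `z`, as pairs of positions. -/
def inversions (z : Perm (Fin n)) : Finset (Fin n × Fin n) :=
  univ.filter fun p => p.1 < p.2 ∧ z p.2 < z p.1

/-- Exchanging the values `i < j` when `i` stands left of `j` and no intermediate value stands
between them creates exactly one inversion. -/
lemma card_inversions_swap_mul (u : Perm (Fin n)) {i j : Fin n} (hij : i < j)
    (hpos : u.symm i < u.symm j)
    (hb : ∀ m, u.symm i < m → m < u.symm j → u m < i ∨ j < u m) :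
    (inversions (swap i j * u)).card = (inversions u).card + 1 := by
  obtain ⟨p, hp⟩ : ∃ p, p = u.symm i := ⟨_, rfl⟩
  obtain ⟨r, hr⟩ : ∃ r, r = u.symm j := ⟨_, rfl⟩
  rw [← hp, ← hr] at hb hpos
  have hup : u p = i := by simp [hp]
  have hur : u r = j := by simp [hr]
  obtain ⟨v, hv⟩ : ∃ v, v = swap i j * u := ⟨_, rfl⟩
  rw [← hv]
  have hvp : v p = j := by simp [hv, hup]
  have hvr : v r = i := by simp [hv, hur]
  have hvm : ∀ m, m ≠ p → m ≠ r → v m = u m := by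
    intro m h1 h2
    rw [hv, Perm.mul_apply, swap_apply_of_ne_of_ne]
    · rintro h; exact h1 (by simp [hp, ← h])
    · rintro h; exact h2 (by simp [hr, ← h])
  have hmem : (p, r) ∈ inversions v := by simp [inversions, hpos, hvp, hvr, hij]
  rw [← Finset.card_erase_add_one hmem]
  congr 1
  let τ : Fin n → Fin n := fun m => if m = p then r else if m = r then p else m
  have τp : τ p = r := by simp [τ]
  have τr : τ r = p := by simp [τ, hpos.ne']
  have τm : ∀ m, m ≠ p → m ≠ r → τ m = m := by
    intro m h1 h2; simp [τ, h1, h2]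
  clear_value τ
  -- Pairs not contained in `[p, r]` are moved by the transposition of `p` and `r`, which turns `u`
  -- into `v`. Pairs inside stay put: by `hb`, replacing `i` by `j` does not alter a comparison with
  -- an entry strictly between. So `φ` is an involution matching the inversions of `u` with those of
  -- `v` other than `(p, r)`.
  let φ : Fin n × Fin n → Fin n × Fin n := fun q =>
    if q.1 < p ∨ r < q.2 then (τ q.1, τ q.2) else q
  have φ1 : ∀ a b, (a < p ∨ r < b) → φ (a, b) = (τ a, τ b) := by
    intro a b h; simp only [φ]; rw [if_pos h]
  have φ2 : ∀ a b, ¬ (a < p ∨ r < b) → φ (a, b) = (a, b) := by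
    intro a b h; simp only [φ]; rw [if_neg h]
  clear_value φ
  have key : ∀ a b, a < b → (a, b) ≠ (p, r) → ∃ a' b', φ (a, b) = (a', b') ∧
      φ (a', b') = (a, b) ∧ a' < b' ∧ (a', b') ≠ (p, r) ∧ (v b' < v a' ↔ u b < u a) := by
    intro a b hab hne
    by_cases hout : a < p ∨ r < b
    · refine ⟨τ a, τ b, φ1 a b hout, ?_⟩
      rcases hout with h | h
      · have ha : τ a = a := τm a h.ne (h.trans hpos).ne
        have hva : v a = u a := hvm a h.ne (h.trans hpos).ne
        rw [ha, φ1 _ _ (Or.inl h), ha]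
        by_cases hbp : b = p
        · subst hbp
          simp only [τp, τr, hvr, hva, hup, ne_eq, Prod.mk.injEq, h.ne,
            not_false_eq_true, and_true, true_and, iff_self]
          exact h.trans hpos
        by_cases hbr : b = r
        · subst hbr
          simp only [τp, τr, hvp, hva, hur, ne_eq, Prod.mk.injEq, h.ne, false_and,
            not_false_eq_true, and_true, true_and, iff_self]
          exact h
        · rw [τm b hbp hbr, τm b hbp hbr, hva, hvm b hbp hbr]
          exact ⟨rfl, hab, by simp [h.ne], Iff.rfl⟩
      · have hb' : τ b = b := τm b (hpos.trans h).ne' h.ne'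
        have hvb : v b = u b := hvm b (hpos.trans h).ne' h.ne'
        rw [hb', φ1 _ _ (Or.inr h), hb']
        by_cases hbp : a = p
        · subst hbp
          simp only [τp, τr, hvr, hvb, hup, ne_eq, Prod.mk.injEq, h.ne', and_false,
            not_false_eq_true, and_true, true_and, iff_self]
          exact h
        by_cases hbr : a = r
        · subst hbr
          simp only [τp, τr, hvp, hvb, hur, ne_eq, Prod.mk.injEq, h.ne', and_false,
            not_false_eq_true, and_true, true_and, iff_self]
          exact hpos.trans h
        · rw [τm a hbp hbr, τm a hbp hbr, hvb, hvm a hbp hbr]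
          exact ⟨rfl, hab, by simp [h.ne'], Iff.rfl⟩
    · refine ⟨a, b, φ2 a b hout, φ2 a b hout, hab, hne, ?_⟩
      push Not at hout
      by_cases hap : a = p
      · have hbr : b ≠ r := by rintro rfl; exact hne (by rw [hap])
        rw [hap] at hab ⊢
        rw [hvp, hup, hvm b hab.ne' hbr]
        rcases hb b hab (lt_of_le_of_ne hout.2 hbr) with h | h
        · exact iff_of_true (h.trans hij) h
        · exact iff_of_false h.not_gt (hij.trans h).not_gt
      by_cases hbr : b = r
      · have hpa : p < a := lt_of_le_of_ne hout.1 (Ne.symm hap)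
        rw [hbr] at hab ⊢
        rw [hvr, hur, hvm a hap hab.ne]
        rcases hb a hpa hab with h | h
        · exact iff_of_false h.not_gt (h.trans hij).not_gt
        · exact iff_of_true (hij.trans h) h
      · rw [hvm a hap (hab.trans_le hout.2).ne, hvm b (hout.1.trans_lt hab).ne' hbr]
  have hupr : ¬ u r < u p := by rw [hup, hur]; exact hij.not_gt
  have mem_u : ∀ a b, (a, b) ∈ inversions u ↔ a < b ∧ u b < u a := by simp [inversions]
  have mem_v : ∀ a b, (a, b) ∈ (inversions v).erase (p, r) ↔
      (a, b) ≠ (p, r) ∧ a < b ∧ v b < v a := by simp [inversions]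
  symm
  refine Finset.card_nbij' φ φ ?_ ?_ ?_ ?_
  · rintro ⟨a, b⟩ h
    rw [mem_coe, mem_u] at h
    have hne : (a, b) ≠ (p, r) := by rintro h'; cases h'; exact hupr h.2
    obtain ⟨a', b', h1, -, h3, h4, h5⟩ := key a b h.1 hne
    rw [h1, mem_coe, mem_v]
    exact ⟨h4, h3, h5.2 h.2⟩
  · rintro ⟨a, b⟩ h
    rw [mem_coe, mem_v] at h
    obtain ⟨a', b', h1, h2, h3, h4, -⟩ := key a b h.2.1 h.1
    obtain ⟨a'', b'', h1', -, -, -, h5'⟩ := key a' b' h3 h4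
    rw [h2] at h1'
    cases h1'
    rw [h1, mem_coe, mem_u]
    exact ⟨h3, h5'.1 h.2.2⟩
  · rintro ⟨a, b⟩ h
    rw [mem_coe, mem_u] at h
    have hne : (a, b) ≠ (p, r) := by rintro h'; cases h'; exact hupr h.2
    obtain ⟨a', b', h1, h2, -⟩ := key a b h.1 hne
    rw [h1, h2]
  · rintro ⟨a, b⟩ h
    rw [mem_coe, mem_v] at h
    obtain ⟨a', b', h1, h2, -⟩ := key a b h.2.1 h.1
    rw [h1, h2]

lemma card_inversions_simple_mul (u : Perm (Fin n)) {i j : Fin n} (hij : (j : ℕ) = i + 1)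
    (hpos : u.symm i < u.symm j) :
    (inversions (swap i j * u)).card = (inversions u).card + 1 := by
  refine card_inversions_swap_mul u (by rw [Fin.lt_def]; omega) hpos fun m h1 h2 => ?_
  by_contra! h
  have h3 : u m ≠ i := by rintro rfl; simp at h1
  have h4 : u m ≠ j := by rintro rfl; simp at h2
  grind

lemma card_inversions_simple_mul_of_gt (u : Perm (Fin n)) {i j : Fin n} (hij : (j : ℕ) = i + 1)
    (hpos : u.symm j < u.symm i) :
    (inversions u).card = (inversions (swap i j * u)).card + 1 := by
  rw [← card_inversions_simple_mul (swap i j * u) hij, ← mul_assoc, swap_mul_self, one_mul]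
  simpa [← Perm.inv_def] using hpos

lemma inversions_one : inversions (1 : Perm (Fin n)) = ∅ := by
  ext p
  simp only [inversions, Perm.coe_one, id_eq, notMem_empty, iff_false]
  grind

lemma lt_of_forall_lt_succ {f : Fin n → Fin n} {a b : Fin n} (hab : a < b)
    (h : ∀ i j : Fin n, (j : ℕ) = i + 1 → a ≤ i → j ≤ b → f i < f j) : f a < f b := by
  obtain ⟨b, hb⟩ := b
  induction b with
  | zero => simp [Fin.lt_def] at hab
  | succ b ih =>
    have hbn : b < n := by omega
    have hlast : f ⟨b, hbn⟩ < f ⟨b + 1, hb⟩ := by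
      refine h _ _ rfl ?_ le_rfl
      rw [Fin.le_def]; rw [Fin.lt_def] at hab; simp at hab ⊢; omega
    by_cases hab' : a = ⟨b, hbn⟩
    · rw [hab']; exact hlast
    · refine (ih hbn ?_ fun i j hij h1 h2 => h i j hij h1 (h2.trans ?_)).trans hlast
      · rw [Fin.lt_def] at *; rw [Fin.ext_iff] at hab'; simp at *; omega
      · rw [Fin.le_def]; simp

lemma perm_eq_one_of_strictMono {f : Perm (Fin n)} (hf : StrictMono f) : f = 1 := by
  have : (hf.orderIsoOfSurjective f f.surjective) = OrderIso.refl _ := Subsingleton.elim _ _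
  ext a
  have := congrArg (fun g : Fin n ≃o Fin n => g a) this
  simpa using congrArg Fin.val this

lemma exists_simple_of_ne_one {z : Perm (Fin n)} (hz : z ≠ 1) :
    ∃ i j : Fin n, (j : ℕ) = i + 1 ∧ z.symm j < z.symm i := by
  by_contra! h
  apply hz
  have : z.symm = 1 := by
    refine perm_eq_one_of_strictMono fun a b hab => lt_of_forall_lt_succ hab fun i j hij _ _ => ?_
    refine lt_of_le_of_ne (h i j hij) fun h' => ?_
    have := z.symm.injective h'
    rw [this] at hij; omega
  rw [← Equiv.symm_symm z, this]; rfl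

lemma exists_word (z : Perm (Fin n)) : ∃ L : List (Perm (Fin n)),
    (∀ s ∈ L, IsSimpleTransposition s) ∧ L.prod = z ∧ L.length = (inversions z).card := by
  induction hk : (inversions z).card generalizing z with
  | zero =>
    refine ⟨[], by simp, ?_, rfl⟩
    by_contra h
    obtain ⟨i, j, hij, hlt⟩ := exists_simple_of_ne_one (Ne.symm h)
    have := card_inversions_simple_mul_of_gt z hij hlt
    omega
  | succ k ih =>
    have hz : z ≠ 1 := by rintro rfl; simp [inversions_one] at hk
    obtain ⟨i, j, hij, hlt⟩ := exists_simple_of_ne_one hz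
    have := card_inversions_simple_mul_of_gt z hij hlt
    obtain ⟨L, h1, h2, h3⟩ := ih (swap i j * z) (by omega)
    refine ⟨swap i j :: L, ?_, ?_, by simp [h3]⟩
    · intro s hs
      rcases List.mem_cons.1 hs with rfl | hs
      · exact ⟨i, j, hij, rfl⟩
      · exact h1 s hs
    · rw [List.prod_cons, h2, ← mul_assoc, swap_mul_self, one_mul]

lemma card_inversions_le_of_word (L : List (Perm (Fin n)))
    (hL : ∀ s ∈ L, IsSimpleTransposition s) : (inversions L.prod).card ≤ L.length := by
  induction L with
  | nil => simp [inversions_one]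
  | cons s L ih =>
    have h1 := ih fun s hs => hL s (List.mem_cons_of_mem _ hs)
    obtain ⟨i, j, hij, rfl⟩ := hL s List.mem_cons_self
    rw [List.prod_cons, List.length_cons]
    rcases lt_trichotomy (L.prod.symm i) (L.prod.symm j) with h | h | h
    · rw [card_inversions_simple_mul _ hij h]; omega
    · have := L.prod.symm.injective h
      rw [this] at hij; omega
    · have := card_inversions_simple_mul_of_gt _ hij h
      omega

/-- Multiplying by a simple transposition changes the number of inversions by exactly one, so no
word is shorter than that number, and sorting attains it. -/
lemma length_eq_card_inversions (z : Perm (Fin n)) : length z = (inversions z).card := by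
  refine le_antisymm (Nat.sInf_le (exists_word z)) ?_
  obtain ⟨L, h1, h2, h3⟩ := Nat.sInf_mem
    (s := {k : ℕ | ∃ L : List (Perm (Fin n)),
      (∀ s ∈ L, IsSimpleTransposition s) ∧ L.prod = z ∧ L.length = k}) ⟨_, exists_word z⟩
  rw [length, ← h3, ← h2]
  exact card_inversions_le_of_word L h1

lemma bruhatCover_swap_mul (u : Perm (Fin n)) {i j : Fin n} (hij : i < j)
    (hpos : u.symm i < u.symm j)
    (hb : ∀ m, u.symm i < m → m < u.symm j → u m < i ∨ j < u m) :
    BruhatCover u (swap i j * u) :=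
  ⟨⟨i, j, hij, rfl⟩, by
    rw [length_eq_card_inversions, length_eq_card_inversions, card_inversions_swap_mul u hij hpos hb]⟩

lemma one_bruhatLE (z : Perm (Fin n)) : BruhatLE 1 z := by
  induction hk : (inversions z).card generalizing z with
  | zero =>
    have : z = 1 := by
      by_contra h
      obtain ⟨i, j, hij, hlt⟩ := exists_simple_of_ne_one h
      have := card_inversions_simple_mul_of_gt z hij hlt
      omega
    rw [this]; exact Relation.ReflTransGen.refl
  | succ k ih =>
    have hz : z ≠ 1 := by rintro rfl; simp [inversions_one] at hk
    obtain ⟨i, j, hij, hlt⟩ := exists_simple_of_ne_one hz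
    have := card_inversions_simple_mul_of_gt z hij hlt
    refine (ih (swap i j * z) (by omega)).tail ⟨⟨i, j, ?_, ?_⟩, ?_⟩
    · rw [Fin.lt_def]; omega
    · rw [← mul_assoc, swap_mul_self, one_mul]
    · rw [length_eq_card_inversions, length_eq_card_inversions, this]

lemma card_inversions_lt_swap_mul (u : Perm (Fin n)) {i j : Fin n} (hij : i < j)
    (hpos : u.symm i < u.symm j) :
    (inversions u).card < (inversions (swap i j * u)).card := by
  induction hd : (j : ℕ) - i using Nat.strong_induction_on generalizing u i j with
  | _ d ih =>
  by_cases hb : ∀ m, u.symm i < m → m < u.symm j → u m < i ∨ j < u m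
  · rw [card_inversions_swap_mul u hij hpos hb]; omega
  push Not at hb
  obtain ⟨m, h1, h2, h3, h4⟩ := hb
  obtain ⟨t, rfl⟩ := u.symm.surjective m
  rw [apply_symm_apply] at h3 h4
  have hti : i < t := lt_of_le_of_ne h3 (by rintro rfl; exact h1.false)
  have htj : t < j := lt_of_le_of_ne h4 (by rintro rfl; exact h2.false)
  -- An intermediate value `t` stands between `i` and `j`. In the factorization `(i j) = (t j)(i
  -- t)(t j)` each factor, when applied, finds its smaller value on the left and has a smaller gap,
  -- so the induction applies three times.
  have hconj : swap i j * u = swap t j * (swap i t * (swap t j * u)) := by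
    rw [← mul_assoc, ← mul_assoc]
    congr 1
    ext x
    simp only [Perm.mul_apply, swap_apply_def]
    grind
  have e1 := ih (j - t) (by rw [Fin.lt_def] at *; omega) u htj h2 rfl
  have e2 := ih (t - i) (by rw [Fin.lt_def] at *; omega) (swap t j * u) hti (by
    simp only [Perm.mul_def, symm_trans_apply, symm_swap, swap_apply_left,
      swap_apply_of_ne_of_ne hti.ne hij.ne]
    exact hpos) rfl
  have e3 := ih (j - t) (by rw [Fin.lt_def] at *; omega) (swap i t * (swap t j * u)) htj (by
    simp only [Perm.mul_def, symm_trans_apply, symm_swap, swap_apply_right,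
      swap_apply_of_ne_of_ne hij.ne' htj.ne', swap_apply_of_ne_of_ne hti.ne hij.ne]
    exact h1) rfl
  rw [hconj]
  omega

/-- In a cover of the Bruhat order the smaller of the two exchanged values stands to the left. -/
lemma BruhatCover.exists_pos {u v : Perm (Fin n)} (h : BruhatCover u v) :
    ∃ a b : Fin n, a < b ∧ u a < u b ∧ v = u * swap a b := by
  obtain ⟨⟨i, j, hij, hv⟩, hlen⟩ := h
  rw [length_eq_card_inversions, length_eq_card_inversions] at hlen
  have hvu : v = u * swap (u.symm i) (u.symm j) := by
    rw [← hv, swap_mul_eq_mul_swap]; rfl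
  refine ⟨u.symm i, u.symm j, ?_, by simpa using hij, hvu⟩
  by_contra! hle
  have hlt : u.symm j < u.symm i := lt_of_le_of_ne hle fun h => hij.ne' (u.symm.injective h)
  have := card_inversions_lt_swap_mul v hij (by
    rw [← hv]
    simpa only [Perm.mul_def, symm_trans_apply, symm_swap, swap_apply_left, swap_apply_right])
  rw [← hv, ← mul_assoc, swap_mul_self, one_mul, hv] at this
  omega

/-! ### Exchanges on a board -/

/-- The permutations that do not raise a label in `A` and do not lower a label outside `A`. -/
def boardPerms (A : Fin n → Prop) : Set (Perm (Fin n)) :=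
  {x | ∀ b, (A b → x b ≤ b) ∧ (¬ A b → b ≤ x b)}

variable {A : Fin n → Prop} {x y : Perm (Fin n)}

/-- The values `x a < x b` can be exchanged within `boardPerms A`. -/
def Exchangeable (A : Fin n → Prop) (x : Perm (Fin n)) (a b : Fin n) : Prop :=
  x a < x b ∧ (A a → x b ≤ a) ∧ (¬ A b → b ≤ x a)

/-- The values `x a < x b` can be exchanged within `boardPerms A`, and `x` fixes all values
strictly between them. -/
def Tight (A : Fin n → Prop) (x : Perm (Fin n)) (a b : Fin n) : Prop :=
  Exchangeable A x a b ∧ ∀ j, x a < j → j < x b → x j = j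

lemma Exchangeable.mul_swap_mem (hx : x ∈ boardPerms A) {a b : Fin n}
    (h : Exchangeable A x a b) : x * swap a b ∈ boardPerms A := by
  obtain ⟨h1, h2, h3⟩ := h
  intro c
  by_cases hca : c = a
  · subst hca
    simp only [Perm.mul_apply, swap_apply_left]
    exact ⟨h2, fun hA => ((hx c).2 hA).trans h1.le⟩
  by_cases hcb : c = b
  · subst hcb
    simp only [Perm.mul_apply, swap_apply_right]
    exact ⟨fun hA => h1.le.trans ((hx c).1 hA), h3⟩
  · simp only [Perm.mul_apply, swap_apply_of_ne_of_ne hca hcb]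
    exact hx c

lemma apply_mem_of_forall_apply_mem {S : Finset (Fin n)} (h : ∀ p, x p ∈ S → p ∈ S) {b : Fin n}
    (hb : b ∈ S) : x b ∈ S := by
  have hmaps : S.image x.symm ⊆ S := by
    intro p hp
    obtain ⟨q, hq, rfl⟩ := Finset.mem_image.1 hp
    exact h _ (by simpa using hq)
  have heq : S.image x.symm = S :=
    Finset.eq_of_subset_of_card_le hmaps (Finset.card_image_of_injective _ x.symm.injective).ge
  rw [← heq] at hb
  obtain ⟨q, hq, rfl⟩ := Finset.mem_image.1 hb
  simpa using hq

/-- The interval `[b, x b)` contains `b` but not `x b`, so `x` does not preserve it, and some value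
in it is held by a label `c` outside. The board condition decides on which side `c` lies. -/
lemma exists_between_of_lt (hx : x ∈ boardPerms A) {b : Fin n} (hb : b < x b) :
    ∃ c, b ≤ x c ∧ x c < x b ∧ (A c → x b ≤ c) ∧ (¬ A c → c < b) := by
  by_contra! h
  have : x b ∈ Finset.Ico b (x b) := by
    refine apply_mem_of_forall_apply_mem (fun p hp => ?_) (Finset.mem_Ico.2 ⟨le_rfl, hb⟩)
    rw [Finset.mem_Ico] at hp ⊢
    have := h p hp.1 hp.2
    have := hx p
    by_cases hA : A p <;> grind
  simp at this

lemma exists_between_of_gt (hx : x ∈ boardPerms A) {a : Fin n} (ha : x a < a) :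
    ∃ c, x a < x c ∧ x c ≤ a ∧ (¬ A c → c ≤ x a) ∧ (A c → a < c) := by
  by_contra! h
  have : x a ∈ Finset.Ioc (x a) a := by
    refine apply_mem_of_forall_apply_mem (fun p hp => ?_) (Finset.mem_Ioc.2 ⟨ha, le_rfl⟩)
    rw [Finset.mem_Ioc] at hp ⊢
    have := h p hp.1 hp.2
    have := hx p
    by_cases hA : A p <;> grind
  simp at this

/-- If `a` holds a value below the cut `q` and may hold one above it, and vice versa for `b`, then
`a` and `b` are joined by a chain of tight exchanges. -/
lemma transGen_tight (hx : x ∈ boardPerms A) {a b : Fin n} {q : ℕ} (ha : (x a : ℕ) < q)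
    (ha' : A a → q ≤ a) (hb : q ≤ x b) (hb' : ¬ A b → (b : ℕ) < q) :
    Relation.TransGen (Tight A x) a b := by
  induction hd : (x b : ℕ) - x a using Nat.strong_induction_on generalizing a b q with
  | _ d ih =>
  subst hd
  -- If `b` may not drop as far as `x a`, the chain is routed through a label `c` with `b ≤ x c < x
  -- b`, using the cuts `b` and `x b`. The case where `a` may not rise to `x b` is symmetric.
  by_cases hcb : ¬ A b ∧ x a < b
  · obtain ⟨hAb, hlt⟩ := hcb
    have := hb' hAb
    obtain ⟨c, h1, h2, h3, h4⟩ := exists_between_of_lt hx (b := b) (by rw [Fin.lt_def]; omega)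
    simp only [Fin.le_def, Fin.lt_def] at *
    refine (ih _ ?_ (q := b) hlt ?_ h1 h4 rfl).trans (ih _ ?_ (q := x b) h2 h3 le_rfl ?_ rfl)
    · omega
    · intro h; have := ha' h; omega
    · omega
    · intro; omega
  by_cases hca : A a ∧ a < x b
  · obtain ⟨hAa, hlt⟩ := hca
    have := ha' hAa
    obtain ⟨c, h1, h2, h3, h4⟩ := exists_between_of_gt hx (a := a) (by rw [Fin.lt_def]; omega)
    simp only [Fin.le_def, Fin.lt_def] at *
    refine (ih _ ?_ (q := x a + 1) (by omega) ?_ h1 ?_ rfl).trans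
      (ih _ ?_ (q := a + 1) (by omega) h4 hlt ?_ rfl)
    · omega
    · intro; omega
    · intro h; have := h3 h; omega
    · omega
    · intro h; have := hb' h; omega
  have hex : Exchangeable A x a b := by
    refine ⟨by rw [Fin.lt_def]; omega, fun h => ?_, fun h => ?_⟩ <;> by_contra! h'
    · exact hca ⟨h, h'⟩
    · exact hcb ⟨h, h'⟩
  by_cases hfix : ∀ j, x a < j → j < x b → x j = j
  · exact .single ⟨hex, hfix⟩
  push Not at hfix
  -- The exchange is allowed but not tight. A label `p` moved by `x` has room to move back by at
  -- least one step, which is what lets it serve as an intermediate link.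
  obtain ⟨j, h1, h2, h3⟩ := hfix
  obtain ⟨p, rfl⟩ := x.surjective j
  have h3 : x p ≠ p := fun h => h3 (congrArg x h)
  obtain ⟨-, e1, e2⟩ := hex
  have e3 := hx p
  rw [Ne, Fin.ext_iff] at h3
  simp only [Fin.le_def, Fin.lt_def] at *
  refine (ih _ ?_ (q := x p) h1 ?_ le_rfl ?_ rfl).trans
    (ih _ ?_ (q := x p + 1) (by omega) ?_ h2 ?_ rfl)
  · omega
  · intro h; have := e1 h; omega
  · intro h; have := e3.2 h; omega
  · omega
  · intro h; have := e3.1 h; omega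
  · intro h; have := e2 h; omega

lemma exists_exchangeable (hx : x ∈ boardPerms A) (h1 : x ≠ 1) :
    ∃ a b, A a ∧ ¬ A b ∧ Exchangeable A x a b := by
  have hne : ∃ b, b < x b := by
    by_contra! h
    apply h1
    ext b
    induction b using WellFoundedLT.induction with
    | _ b ih =>
    rcases (h b).lt_or_eq with hlt | heq
    · have := x.injective (Fin.ext (ih _ hlt))
      exact absurd this hlt.ne
    · simp [heq]
  -- Take the raised label with the smallest value. A partner `c` outside `A` would satisfy `c < b ≤
  -- x c`, hence be raised too, with a smaller value.
  obtain ⟨b, hb, hmin⟩ := Set.exists_min_image {b | b < x b} x (Set.toFinite _) hne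
  obtain ⟨c, c1, c2, c3, c4⟩ := exists_between_of_lt hx hb
  by_cases hAc : A c
  · refine ⟨c, b, hAc, fun hA => ?_, c2, c3, fun _ => c1⟩
    exact ((hx b).1 hA).not_gt hb
  · exact absurd (hmin c ((c4 hAc).trans_le c1)) c2.not_ge

/-- Among the exchanges of a label in `A` with a label outside `A` there is one of minimal gap. -/
lemma exists_exchangeable_min (hx : x ∈ boardPerms A) (h1 : x ≠ 1) :
    ∃ a b, A a ∧ ¬ A b ∧ Exchangeable A x a b ∧
      ∀ p, x a < x p → x p < x b → (A p → p ≤ a) ∧ (¬ A p → b ≤ p) := by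
  obtain ⟨a, b, hA, hB, h⟩ := exists_exchangeable hx h1
  obtain ⟨⟨a, b⟩, ⟨hA, hB, h⟩, hmin⟩ := Set.exists_min_image
    {q : Fin n × Fin n | A q.1 ∧ ¬ A q.2 ∧ Exchangeable A x q.1 q.2}
    (fun q => (x q.2 : ℕ) - x q.1) (Set.toFinite _) ⟨(a, b), hA, hB, h⟩
  refine ⟨a, b, hA, hB, h, fun p h1 h2 => ⟨fun hp => ?_, fun hp => ?_⟩⟩ <;> by_contra! hlt
  · have e1 := h.2.1 hA
    have e2 := h.2.2 hB
    have := hmin (p, b) ⟨hp, hB, h2, fun _ => e1.trans hlt.le, fun _ => e2.trans h1.le⟩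
    simp only [Fin.lt_def] at *
    omega
  · have e1 := h.2.1 hA
    have e2 := h.2.2 hB
    have := hmin (a, p) ⟨hA, hp, h1, fun _ => h2.le.trans e1, fun _ => hlt.le.trans e2⟩
    simp only [Fin.lt_def] at *
    omega

lemma apply_lt_of_transGen_tight {a b : Fin n} (h : Relation.TransGen (Tight A x) a b) :
    x a < x b := by
  induction h with
  | single h => exact h.1.1
  | tail _ h ih => exact ih.trans h.1.1

/-! ### Linear functionals maximized on a board -/

section Functional

lemma sum_le_sum_of_forall_le {ι : Type*} {P M : Finset ι} (hcard : P.card = M.card) {c : ι → ℝ}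
    (h : ∀ a ∈ P, ∀ b ∈ M, c a ≤ c b) :
    ∑ a ∈ P, c a ≤ ∑ b ∈ M, c b ∧
      (∑ a ∈ P, c a = ∑ b ∈ M, c b → ∀ a ∈ P, ∀ b ∈ M, c a = c b) := by
  -- Averaging over all pairs avoids choosing a bijection between `P` and `M`.
  have key : ∑ a ∈ P, ∑ b ∈ M, (c b - c a) = P.card * (∑ b ∈ M, c b - ∑ a ∈ P, c a) := by
    simp only [Finset.sum_sub_distrib, Finset.sum_const, nsmul_eq_mul, ← Finset.mul_sum]
    rw [hcard]; ring
  have hnn : ∀ a ∈ P, 0 ≤ ∑ b ∈ M, (c b - c a) := fun a ha =>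
    Finset.sum_nonneg fun b hb => sub_nonneg.2 (h a ha b hb)
  refine ⟨?_, fun heq a ha b hb => ?_⟩
  · rcases P.eq_empty_or_nonempty with rfl | hP
    · rw [Finset.card_empty, eq_comm, Finset.card_eq_zero] at hcard
      rw [hcard]
    · have h0 := Finset.sum_nonneg hnn
      rw [key] at h0
      exact sub_nonneg.1 (nonneg_of_mul_nonneg_right h0 (by exact_mod_cast hP.card_pos))
  · rw [heq, sub_self, mul_zero, Finset.sum_eq_zero_iff_of_nonneg hnn] at key
    have := (Finset.sum_eq_zero_iff_of_nonneg fun b hb => sub_nonneg.2 (h a ha b hb)).1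
      (key a ha) b hb
    linarith

lemma natCast_eq_sum_ite {k m : ℕ} (hk : k ≤ m) :
    (k : ℝ) = ∑ q ∈ Finset.range m, if q + 1 ≤ k then 1 else 0 := by
  rw [Finset.sum_boole]
  congr 1
  have : (Finset.range m).filter (fun q => q + 1 ≤ k) = Finset.range k := by
    ext q; simp only [Finset.mem_filter, Finset.mem_range]; omega
  rw [this, Finset.card_range]

/-- The labels whose value goes up across the cut `q` on passing from `x` to `y`. -/
def crossers (x y : Perm (Fin n)) (q : ℕ) : Finset (Fin n) :=
  univ.filter fun a => (x a : ℕ) < q ∧ q ≤ y a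

lemma mem_crossers {q : ℕ} {a : Fin n} : a ∈ crossers x y q ↔ (x a : ℕ) < q ∧ q ≤ y a := by
  simp [crossers]

lemma card_crossers (x y : Perm (Fin n)) (q : ℕ) :
    (crossers x y q).card = (crossers y x q).card := by
  have hcard : ∀ z : Perm (Fin n), (univ.filter fun a => q ≤ (z a : ℕ)).card =
      (univ.filter fun a : Fin n => q ≤ (a : ℕ)).card := fun z =>
    Finset.card_equiv z (by simp)
  have hdiff : ∀ x y : Perm (Fin n), crossers x y q =
      (univ.filter fun a => q ≤ (y a : ℕ)) \ (univ.filter fun a => q ≤ (x a : ℕ)) := by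
    intro x y; ext a; simp [mem_crossers, and_comm]
  rw [hdiff, hdiff]
  exact Finset.card_sdiff_comm ((hcard y).trans (hcard x).symm)

/-- A functional that increases along tight exchanges is maximal over `boardPerms A` at `x`. -/
lemma sum_mul_le_of_tight (hx : x ∈ boardPerms A) (hy : y ∈ boardPerms A) {c : Fin n → ℝ}
    (hc : ∀ a b, Tight A x a b → c a ≤ c b) :
    ∑ a, c a * ((y a : ℕ) : ℝ) ≤ ∑ a, c a * ((x a : ℕ) : ℝ) ∧
      (∑ a, c a * ((y a : ℕ) : ℝ) = ∑ a, c a * ((x a : ℕ) : ℝ) →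
        ∀ q, ∀ a ∈ crossers x y (q + 1), ∀ b ∈ crossers y x (q + 1), c a = c b) := by
  have hmono : ∀ a b, Relation.TransGen (Tight A x) a b → c a ≤ c b := by
    intro a b h
    induction h with
    | single h => exact hc _ _ h
    | tail _ h ih => exact ih.trans (hc _ _ h)
  -- Here `y` itself certifies that `a` may rise above the cut and `b` may fall below it.
  have hpair : ∀ q, ∀ a ∈ crossers x y q, ∀ b ∈ crossers y x q, c a ≤ c b := by
    intro q a ha b hb
    rw [mem_crossers] at ha hb
    refine hmono _ _ (transGen_tight hx ha.1 (fun h => ?_) hb.2 fun h => ?_)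
    · exact ha.2.trans ((hy a).1 h)
    · exact lt_of_le_of_lt ((hy b).2 h) hb.1
  have hstep := fun q => sum_le_sum_of_forall_le (card_crossers x y q) (hpair q)
  -- Layer-cake summation: each value is the number of cuts below it, and at every cut only the
  -- labels crossing it contribute to the difference.
  have key : ∑ a, c a * ((x a : ℕ) : ℝ) - ∑ a, c a * ((y a : ℕ) : ℝ) =
      ∑ q ∈ Finset.range n,
        (∑ b ∈ crossers y x (q + 1), c b - ∑ a ∈ crossers x y (q + 1), c a) := by
    simp only [crossers, Finset.sum_filter, ← Finset.sum_sub_distrib]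
    rw [Finset.sum_comm]
    refine Finset.sum_congr rfl fun a _ => ?_
    rw [natCast_eq_sum_ite (x a).is_lt.le, natCast_eq_sum_ite (y a).is_lt.le, ← mul_sub,
      ← Finset.sum_sub_distrib, Finset.mul_sum]
    refine Finset.sum_congr rfl fun q _ => ?_
    by_cases h1 : q + 1 ≤ (x a : ℕ) <;> by_cases h2 : q + 1 ≤ (y a : ℕ) <;>
      simp [h1, h2, not_lt.2, not_le.1]
  have hnn : ∀ q ∈ Finset.range n,
      0 ≤ ∑ b ∈ crossers y x (q + 1), c b - ∑ a ∈ crossers x y (q + 1), c a :=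
    fun q _ => sub_nonneg.2 (hstep (q + 1)).1
  refine ⟨sub_nonneg.1 (key ▸ Finset.sum_nonneg hnn), fun heq q a ha b hb => ?_⟩
  rw [heq, sub_self, eq_comm, Finset.sum_eq_zero_iff_of_nonneg hnn] at key
  have hq : q < n := by rw [mem_crossers] at ha; have := (y a).is_lt; omega
  exact (hstep (q + 1)).2 (sub_eq_zero.1 (key q (Finset.mem_range.2 hq))).symm a ha b hb

lemma exists_mem_crossers_of_lt {p : Fin n} (h : x p < y p) :
    ∃ q, p ∈ crossers x y (q + 1) ∧ ∃ b, b ∈ crossers y x (q + 1) := by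
  have hp : p ∈ crossers x y ((y p : ℕ) - 1 + 1) := by
    rw [mem_crossers]; rw [Fin.lt_def] at h; omega
  refine ⟨_, hp, Finset.card_pos.1 ?_⟩
  rw [← card_crossers]
  exact Finset.card_pos.2 ⟨p, hp⟩

/-- A strict local maximum is a strict global maximum. -/
lemma eq_of_sum_mul_eq (hx : x ∈ boardPerms A) (hy : y ∈ boardPerms A) {c : Fin n → ℝ}
    (hc : ∀ a b, Tight A x a b → c a < c b)
    (heq : ∑ a, c a * ((y a : ℕ) : ℝ) = ∑ a, c a * ((x a : ℕ) : ℝ)) : y = x := by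
  have hlt : ∀ a b, Relation.TransGen (Tight A x) a b → c a < c b := by
    intro a b h
    induction h with
    | single h => exact hc _ _ h
    | tail _ h ih => exact ih.trans (hc _ _ h)
  have heq' := (sum_mul_le_of_tight hx hy fun a b h => (hc a b h).le).2 heq
  have hno : ∀ q a b, a ∈ crossers x y (q + 1) → b ∈ crossers y x (q + 1) → False := by
    intro q a b ha hb
    refine (hlt a b ?_).ne (heq' q a ha b hb)
    rw [mem_crossers] at ha hb
    exact transGen_tight hx ha.1 (fun h => ha.2.trans ((hy a).1 h)) hb.2
      fun h => lt_of_le_of_lt ((hy b).2 h) hb.1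
  ext p
  by_contra hne
  rcases lt_or_gt_of_ne (fun h : x p = y p => hne (by rw [h])) with h | h
  · obtain ⟨q, ha, b, hb⟩ := exists_mem_crossers_of_lt h
    exact hno q _ _ ha hb
  · obtain ⟨q, hb, a, ha⟩ := exists_mem_crossers_of_lt h
    exact hno q _ _ ha hb

/-- A functional increasing along all tight exchanges of `x` but one, along which it is constant,
is maximal exactly at `x` and at the result of that exchange. -/
lemma eq_or_eq_mul_swap_of_sum_mul_eq (hx : x ∈ boardPerms A) (hy : y ∈ boardPerms A)
    {c : Fin n → ℝ} {a₀ b₀ : Fin n} (h₀ : c a₀ = c b₀)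
    (hc : ∀ a b, Tight A x a b → c a < c b ∨ a = a₀ ∧ b = b₀)
    (heq : ∑ a, c a * ((y a : ℕ) : ℝ) = ∑ a, c a * ((x a : ℕ) : ℝ)) :
    y = x ∨ y = x * swap a₀ b₀ := by
  have hle : ∀ a b, Tight A x a b → c a ≤ c b := by
    intro a b h
    rcases hc a b h with h | ⟨rfl, rfl⟩
    exacts [h.le, h₀.le]
  -- A chain of at least two exchanges contains a strict one: the exceptional exchange cannot follow
  -- itself, because values of `x` strictly increase along a chain.
  have hlt : ∀ a b, Relation.TransGen (Tight A x) a b → c a < c b ∨ a = a₀ ∧ b = b₀ := by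
    intro a b h
    induction h with
    | single h => exact hc _ _ h
    | tail hab h ih =>
      rcases ih with ih | ⟨rfl, rfl⟩
      · exact Or.inl (ih.trans_le (hle _ _ h))
      · rcases hc _ _ h with h' | ⟨h', -⟩
        · exact Or.inl (h₀.trans_lt h')
        · rw [h'] at hab
          exact absurd (apply_lt_of_transGen_tight hab) (lt_irrefl _)
  have heq' := (sum_mul_le_of_tight hx hy hle).2 heq
  have hno : ∀ q a b, a ∈ crossers x y (q + 1) → b ∈ crossers y x (q + 1) →
      a = a₀ ∧ b = b₀ := by
    intro q a b ha hb
    refine (hlt a b ?_).resolve_left (heq' q a ha b hb).not_lt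
    rw [mem_crossers] at ha hb
    exact transGen_tight hx ha.1 (fun h => ha.2.trans ((hy a).1 h)) hb.2
      fun h => lt_of_le_of_lt ((hy b).2 h) hb.1
  have hagree : ∀ p, p ≠ a₀ → p ≠ b₀ → y p = x p := by
    intro p hpa hpb
    by_contra hne
    rcases lt_or_gt_of_ne (Ne.symm hne) with h | h
    · obtain ⟨q, ha, b, hb⟩ := exists_mem_crossers_of_lt h
      exact hpa (hno q _ _ ha hb).1
    · obtain ⟨q, hb, a, ha⟩ := exists_mem_crossers_of_lt h
      exact hpb (hno q _ _ ha hb).2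
  have hsymm : ∀ p, (p = a₀ ∨ p = b₀) → y p = x a₀ ∨ y p = x b₀ := by
    intro p hp
    obtain ⟨r, hr⟩ := x.surjective (y p)
    by_cases hra : r = a₀
    · exact Or.inl (by rw [← hr, hra])
    by_cases hrb : r = b₀
    · exact Or.inr (by rw [← hr, hrb])
    · have := y.injective ((hagree r hra hrb).trans hr)
      rcases hp with rfl | rfl
      exacts [absurd this hra, absurd this hrb]
  by_cases hab : a₀ = b₀
  · subst hab
    left
    ext p
    by_cases hp : p = a₀
    · rw [hp, (or_self_iff.1 (hsymm a₀ (Or.inl rfl)))]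
    · rw [hagree p hp hp]
  have hne : y a₀ ≠ y b₀ := fun h => hab (y.injective h)
  rcases hsymm a₀ (Or.inl rfl) with h1 | h1
  · have h2 : y b₀ = x b₀ := (hsymm b₀ (Or.inr rfl)).resolve_left fun h => hne (h1.trans h.symm)
    left
    ext p
    by_cases hpa : p = a₀
    · rw [hpa, h1]
    by_cases hpb : p = b₀
    · rw [hpb, h2]
    rw [hagree p hpa hpb]
  · have h2 : y b₀ = x a₀ := (hsymm b₀ (Or.inr rfl)).resolve_right fun h => hne (h1.trans h.symm)
    right
    ext p
    rw [Perm.mul_apply]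
    by_cases hpa : p = a₀
    · rw [hpa, swap_apply_left, h1]
    by_cases hpb : p = b₀
    · rw [hpb, swap_apply_right, h2]
    rw [swap_apply_of_ne_of_ne hpa hpb, hagree p hpa hpb]

lemma sum_mul_mul_swap (x : Perm (Fin n)) (c : Fin n → ℝ) {a b : Fin n} (hab : a ≠ b) :
    ∑ k, c k * (((x * swap a b) k : ℕ) : ℝ) =
      ∑ k, c k * ((x k : ℕ) : ℝ) + (c a - c b) * (((x b : ℕ) : ℝ) - ((x a : ℕ) : ℝ)) := by
  have hpt : ∀ k, c k * (((x * swap a b) k : ℕ) : ℝ) = c k * ((x k : ℕ) : ℝ) +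
      (if k = a then c a * (((x b : ℕ) : ℝ) - ((x a : ℕ) : ℝ)) else 0) +
      (if k = b then c b * (((x a : ℕ) : ℝ) - ((x b : ℕ) : ℝ)) else 0) := by
    intro k
    by_cases hka : k = a
    · subst hka
      simp only [Perm.mul_apply, swap_apply_left, if_true, if_neg hab]
      ring
    by_cases hkb : k = b
    · subst hkb
      simp only [Perm.mul_apply, swap_apply_right, if_true, if_neg hka]
      ring
    · simp [swap_apply_of_ne_of_ne hka hkb, hka, hkb]
  simp only [hpt, Finset.sum_add_distrib, Finset.sum_ite_eq', mem_univ, if_true]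
  ring

/-- For a tight exchange there is a functional that increases along all other tight exchanges. -/
lemma Tight.exists_functional {a₀ b₀ : Fin n} (h : Tight A x a₀ b₀) :
    ∃ c : Fin n → ℝ, c a₀ = c b₀ ∧ ∀ a b, Tight A x a b → c a < c b ∨ a = a₀ ∧ b = b₀ := by
  classical
  obtain ⟨⟨hlt, hA, hB⟩, hfix⟩ := h
  -- Labels with values strictly between `x a₀` and `x b₀` are fixed by `x`: those in `A` cannot
  -- rise and those outside `A` cannot fall. The latter occur only as the lower label of a tight
  -- exchange, so they can be pushed below `c b₀ = x a₀`. Integers are needed since `x a₀` may be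
  -- `0`.
  let c : Fin n → ℤ := fun a =>
    if a = b₀ then (x a₀ : ℕ) else
      if x a₀ < x a ∧ x a < x b₀ ∧ ¬ A a then (x a₀ : ℕ) - 1 else (x a : ℕ)
  have hc : ∀ a b, Tight A x a b → c a < c b ∨ a = a₀ ∧ b = b₀ := by
    rintro a b ⟨⟨h1, h2, h3⟩, -⟩
    have hne : a ≠ b := by rintro rfl; exact h1.false
    have ea : x a₀ < x a → x a < x b₀ → x a = a := fun e e' => x.injective (hfix _ e e')
    have eb : x a₀ < x b → x b < x b₀ → x b = b := fun e e' => x.injective (hfix _ e e')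
    have ia : a ≠ a₀ → (x a : ℕ) ≠ x a₀ := fun h h' => h (x.injective (Fin.ext h'))
    have ib : b ≠ a₀ → (x b : ℕ) ≠ x a₀ := fun h h' => h (x.injective (Fin.ext h'))
    have ja : a ≠ b₀ → (x a : ℕ) ≠ x b₀ := fun h h' => h (x.injective (Fin.ext h'))
    have jb : b ≠ b₀ → (x b : ℕ) ≠ x b₀ := fun h h' => h (x.injective (Fin.ext h'))
    have ka : a = a₀ → x a = x a₀ := congrArg x
    have kb : b = a₀ → x b = x a₀ := congrArg x
    have la : a = b₀ → x a = x b₀ := congrArg x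
    have lb : b = b₀ → x b = x b₀ := congrArg x
    simp only [c]
    simp only [Fin.lt_def, Fin.le_def, Fin.ext_iff] at *
    split_ifs <;> grind
  refine ⟨fun a => c a, ?_, fun a b hab => ?_⟩
  · have : a₀ ≠ b₀ := by rintro rfl; exact hlt.false
    simp [c, this]
  · rcases hc a b hab with h | h
    · exact Or.inl (Int.cast_lt.2 h)
    · exact Or.inr h

end Functional

/-! ### The interval below a Grassmannian permutation -/

variable {w : Perm (Fin n)}

/-- `D` cuts the positions into an initial and a final part, on each of which `w` increases. -/
structure IsCut (w : Perm (Fin n)) (D : Fin n → Prop) : Prop where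
  lt_of_not : ∀ a b, D a → ¬ D b → a < b
  mono_left : ∀ a b, D a → D b → a < b → w a < w b
  mono_right : ∀ a b, ¬ D a → ¬ D b → a < b → w a < w b

lemma lt_of_forall_notMem_descents {a b : Fin n} (hab : a < b)
    (h : ∀ d, a ≤ d → d < b → d ∉ descents w) : w a < w b := by
  refine lt_of_forall_lt_succ hab fun i j hij h1 h2 => ?_
  have hlt : i < j := by rw [Fin.lt_def]; omega
  by_contra! hle
  exact h i h1 (hlt.trans_le h2) ⟨j, hij, lt_of_le_of_ne hle (w.injective.ne hlt.ne')⟩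

lemma IsGrassmannian.exists_isCut (hw : IsGrassmannian w) : ∃ D : Fin n → Prop, IsCut w D := by
  have huniq : ∀ d ∈ descents w, ∀ d' ∈ descents w, d = d' := fun d hd d' hd' =>
    (Set.ncard_le_one (Set.toFinite _)).1 hw d hd d' hd'
  -- The cut comes just after the descent; without a descent every position lies on the left.
  refine ⟨fun a => ∀ d ∈ descents w, a ≤ d, ?_, ?_, ?_⟩
  · intro a b ha hb
    push Not at hb
    obtain ⟨d, hd, hdb⟩ := hb
    exact (ha d hd).trans_lt hdb
  · intro a b _ hb hab
    exact lt_of_forall_notMem_descents hab fun d _ h2 hd => (hb d hd).not_gt h2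
  · intro a b ha _ hab
    push Not at ha
    obtain ⟨d, hd, hda⟩ := ha
    exact lt_of_forall_notMem_descents hab fun e h1 _ he =>
      (hda.trans_le h1).ne (huniq d hd e he)

/-- The board of labels (the values of `w`) cut out by `D`. -/
def labelBoard (w : Perm (Fin n)) (D : Fin n → Prop) : Set (Perm (Fin n)) :=
  boardPerms fun b => D (w.symm b)

lemma mul_inv_mem_labelBoard {D : Fin n → Prop} {z : Perm (Fin n)} :
    z * w⁻¹ ∈ labelBoard w D ↔ ∀ k, (D k → z k ≤ w k) ∧ (¬ D k → w k ≤ z k) := by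
  refine ⟨fun h k => by simpa using h (w k), fun h b => ?_⟩
  simpa using h (w.symm b)

lemma BruhatLE.mem_labelBoard {D : Fin n → Prop} (hD : IsCut w D) {z : Perm (Fin n)}
    (hz : BruhatLE z w) : z * w⁻¹ ∈ labelBoard w D := by
  rw [mul_inv_mem_labelBoard]
  induction hz using Relation.ReflTransGen.head_induction_on with
  | refl => exact fun k => ⟨fun _ => le_rfl, fun _ => le_rfl⟩
  | head h _ ih =>
    obtain ⟨a, b, hab, hlt, rfl⟩ := h.exists_pos
    have ha := ih a
    have hb := ih b
    simp only [Perm.mul_apply, swap_apply_left, swap_apply_right] at ha hb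
    intro k
    by_cases hka : k = a
    · subst hka
      refine ⟨fun h => hlt.le.trans (ha.1 h), fun h => ?_⟩
      have hDb : ¬ D b := fun h' => (hD.lt_of_not _ _ h' h).not_gt hab
      exact (hD.mono_right _ _ h hDb hab).le.trans (hb.2 hDb)
    by_cases hkb : k = b
    · subst hkb
      refine ⟨fun h => ?_, fun h => (hb.2 h).trans hlt.le⟩
      have hDa : D a := by
        by_contra h'
        exact (hD.lt_of_not _ _ h h').not_gt hab
      exact (ha.1 hDa).trans (hD.mono_left _ _ hDa h hab).le
    · simpa [swap_apply_of_ne_of_ne hka hkb] using ih k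

/-- An exchange of minimal gap is a cover: since `w` increases on each side of the cut, an
intermediate entry standing between the two would give an exchange of smaller gap. -/
lemma exists_bruhatCover_of_mem_labelBoard {D : Fin n → Prop} (hD : IsCut w D)
    {z : Perm (Fin n)} (hz : z * w⁻¹ ∈ labelBoard w D) (hne : z ≠ w) :
    ∃ z', BruhatCover z z' ∧ z' * w⁻¹ ∈ labelBoard w D := by
  obtain ⟨a, b, ha, hb, hex, hmin⟩ := exists_exchangeable_min hz
    (fun h => hne (mul_inv_eq_one.1 h))
  have hmem := hex.mul_swap_mem hz
  obtain ⟨p, rfl⟩ := w.surjective a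
  obtain ⟨r, rfl⟩ := w.surjective b
  rw [symm_apply_apply] at ha hb
  have hmin' : ∀ m, z p < z m → z m < z r → (D m → w m ≤ w p) ∧ (¬ D m → w r ≤ w m) := by
    intro m
    simpa using hmin (w m)
  have hlt : z p < z r := by simpa using hex.1
  have hcov := bruhatCover_swap_mul z hlt (by simpa using hD.lt_of_not _ _ ha hb) (by
    intro m h1 h2
    rw [symm_apply_apply] at h1 h2
    by_contra! hcon
    have hm := hmin' m (lt_of_le_of_ne hcon.1 (z.injective.ne h1.ne))
      (lt_of_le_of_ne hcon.2 (z.injective.ne h2.ne))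
    by_cases hDm : D m
    · exact (hm.1 hDm).not_gt (hD.mono_left _ _ ha hDm h1)
    · exact (hm.2 hDm).not_gt (hD.mono_right _ _ hDm hb h2))
  refine ⟨_, hcov, ?_⟩
  rw [labelBoard]
  rw [mul_swap_eq_swap_mul] at hmem
  rw [mul_assoc]
  simpa using hmem

/-- The lower Bruhat interval of a Grassmannian permutation consists of the permutations with no
larger entries before the descent and no smaller entries after it. -/
lemma mem_bruhatInterval_iff {D : Fin n → Prop} (hD : IsCut w D) {z : Perm (Fin n)} :
    z ∈ bruhatInterval 1 w ↔ z * w⁻¹ ∈ labelBoard w D := by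
  refine ⟨fun h => h.2.mem_labelBoard hD, fun h => ⟨one_bruhatLE z, ?_⟩⟩
  by_contra hz
  -- A longest counterexample still has a cover on the board, which by maximality is below `w`.
  obtain ⟨y, ⟨hy, hyw⟩, hmax⟩ := Set.exists_max_image
    {z : Perm (Fin n) | z * w⁻¹ ∈ labelBoard w D ∧ ¬ BruhatLE z w} length (Set.toFinite _)
    ⟨z, h, hz⟩
  obtain ⟨y', hcov, hy'⟩ := exists_bruhatCover_of_mem_labelBoard hD hy
    (by rintro rfl; exact hyw .refl)
  have hle : BruhatLE y' w := by
    by_contra hle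
    have := hmax y' ⟨hy', hle⟩
    rw [hcov.2] at this
    omega
  exact hyw (.head hcov hle)

/-! ### Faces of convex hulls of permutation points -/

section Polytope

lemma convex_halfSpace_union {E : Type*} [AddCommGroup E] [Module ℝ E] (f : E →ₗ[ℝ] ℝ)
    {M : ℝ} {S : Set E} (hS : Convex ℝ S) (hM : ∀ s ∈ S, f s = M) :
    Convex ℝ ({z | f z < M} ∪ S) := by
  intro p hp q hq s t hs ht hst
  rcases hs.eq_or_lt with rfl | hs
  · rw [zero_add] at hst; simpa [hst] using hq
  rcases ht.eq_or_lt with rfl | ht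
  · rw [add_zero] at hst; simpa [hst] using hp
  have hle : ∀ z ∈ {z | f z < M} ∪ S, f z ≤ M := by
    rintro z (hz | hz)
    exacts [le_of_lt hz, (hM z hz).le]
  have hf : f (s • p + t • q) = s * f p + t * f q := by simp
  have hsM : M = s * M + t * M := by rw [← add_mul, hst, one_mul]
  rcases hp with hp | hp
  · left
    have := mul_lt_mul_of_pos_left (show f p < M from hp) hs
    have := mul_le_mul_of_nonneg_left (hle q hq) ht.le
    change f _ < M
    linarith
  rcases hq with hq | hq
  · left
    have := mul_lt_mul_of_pos_left (show f q < M from hq) ht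
    have := mul_le_mul_of_nonneg_left (hM p hp).le hs.le
    change f _ < M
    linarith
  · exact Or.inr (hS hp hq hs.le ht.le hst)

/-- If `f ≤ M` on `V` and the points of `V` with `f = M` lie in a convex set `S` inside the
polytope, on which `f = M`, then `S` is a face of the convex hull of `V`. -/
lemma isExposed_convexHull {E : Type*} [AddCommGroup E] [Module ℝ E] [TopologicalSpace E]
    (f : StrongDual ℝ E) {M : ℝ} {V S : Set E} (hS : Convex ℝ S) (hSV : S ⊆ convexHull ℝ V)
    (hM : ∀ s ∈ S, f s = M) (hV : ∀ z ∈ V, f z < M ∨ z ∈ S) :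
    IsExposed ℝ (convexHull ℝ V) S := by
  rintro ⟨s, hs⟩
  have hsub : convexHull ℝ V ⊆ {z | f z < M} ∪ S :=
    convexHull_min hV (convex_halfSpace_union f.toLinearMap hS hM)
  refine ⟨f, Set.Subset.antisymm (fun z hz => ⟨hSV hz, fun y hy => ?_⟩) fun z hz => ?_⟩
  · rw [hM z hz]
    rcases hsub hy with h | h
    exacts [le_of_lt h, (hM y h).le]
  · refine (hsub hz.1).resolve_left fun h => ?_
    have := hz.2 s (hSV hs)
    rw [hM s hs] at this
    exact this.not_gt h

/-- The functional `p ↦ ∑ k, d k * p k`. -/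
noncomputable def dotFunctional (d : Fin n → ℝ) : StrongDual ℝ (Fin n → ℝ) :=
  ∑ k, d k • ContinuousLinearMap.proj (R := ℝ) (φ := fun _ : Fin n => ℝ) k

lemma dotFunctional_apply (d p : Fin n → ℝ) : dotFunctional d p = ∑ k, d k * p k := by
  simp [dotFunctional]

lemma permPoint_injective : Function.Injective (permPoint : Perm (Fin n) → Fin n → ℝ) := by
  intro y z h
  ext k
  have := congrFun h k
  simpa [permPoint] using this

lemma sum_sq_permPoint (z : Perm (Fin n)) :
    ∑ k, permPoint z k ^ 2 = ∑ k : Fin n, (((k : ℕ) : ℝ) + 1) ^ 2 :=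
  Equiv.sum_comp z fun k : Fin n => (((k : ℕ) : ℝ) + 1) ^ 2

/-- All permutation points lie on one sphere about the origin, so the inner product with `permPoint
z` is largest at `permPoint z` alone. -/
lemma dotFunctional_permPoint_lt {y z : Perm (Fin n)} (h : y ≠ z) :
    dotFunctional (permPoint z) (permPoint y) < dotFunctional (permPoint z) (permPoint z) := by
  simp only [dotFunctional_apply]
  have hpos : 0 < ∑ k, (permPoint y k - permPoint z k) ^ 2 := by
    obtain ⟨k, hk⟩ := Function.ne_iff.1 (permPoint_injective.ne h)
    refine Finset.sum_pos' (fun _ _ => sq_nonneg _) ⟨k, mem_univ _, ?_⟩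
    exact sq_pos_of_ne_zero (sub_ne_zero.2 hk)
  have hexp : ∑ k, (permPoint y k - permPoint z k) ^ 2 = ∑ k, permPoint y k ^ 2 +
      ∑ k, permPoint z k ^ 2 - 2 * ∑ k, permPoint z k * permPoint y k := by
    rw [Finset.mul_sum, ← Finset.sum_add_distrib, ← Finset.sum_sub_distrib]
    exact Finset.sum_congr rfl fun k _ => by ring
  rw [sum_sq_permPoint, ← sum_sq_permPoint z] at hexp
  have : ∑ k, permPoint z k ^ 2 = ∑ k, permPoint z k * permPoint z k :=
    Finset.sum_congr rfl fun k _ => sq _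
  linarith

lemma permPoint_mem_extremePoints {I : Set (Perm (Fin n))} {z : Perm (Fin n)} (hz : z ∈ I) :
    permPoint z ∈ (convexHull ℝ (permPoint '' I)).extremePoints ℝ := by
  refine exposedPoints_subset_extremePoints (mem_exposedPoints_iff_exposed_singleton.2 ?_)
  refine isExposed_convexHull (dotFunctional (permPoint z))
    (M := dotFunctional (permPoint z) (permPoint z)) (convex_singleton _) ?_ ?_ ?_
  · exact Set.singleton_subset_iff.2 (subset_convexHull ℝ _ (Set.mem_image_of_mem _ hz))
  · rintro s rfl; rfl
  · rintro _ ⟨y, -, rfl⟩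
    by_cases h : y = z
    · exact Or.inr (by rw [h]; rfl)
    · exact Or.inl (dotFunctional_permPoint_lt h)

lemma eq_or_eq_of_permPoint_mem_segment {u v z : Perm (Fin n)}
    (h : permPoint z ∈ segment ℝ (permPoint u) (permPoint v)) : z = u ∨ z = v := by
  by_contra! hne
  have hsub : segment ℝ (permPoint u) (permPoint v) ⊆
      {p | dotFunctional (permPoint z) p < dotFunctional (permPoint z) (permPoint z)} := by
    refine (convex_halfSpace_lt (dotFunctional (permPoint z)).toLinearMap.isLinear _).segment_subset
      ?_ ?_
    · exact dotFunctional_permPoint_lt hne.1.symm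
    · exact dotFunctional_permPoint_lt hne.2.symm
  exact lt_irrefl (dotFunctional (permPoint z) (permPoint z)) (hsub h)

/-- Evaluation of a functional at a permutation, in terms of labels. -/
lemma dotFunctional_permPoint (d : Fin n → ℝ) (w z : Perm (Fin n)) :
    dotFunctional d (permPoint z) =
      ∑ b, d (w.symm b) * ((((z * w⁻¹) b : Fin n) : ℕ) : ℝ) + ∑ k, d k := by
  rw [dotFunctional_apply, ← Equiv.sum_comp w (fun b => d (w.symm b) * _),
    ← Finset.sum_add_distrib]
  exact Finset.sum_congr rfl fun k _ => by simp [permPoint, mul_add]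

lemma eq_dotFunctional (f : StrongDual ℝ (Fin n → ℝ)) :
    f = dotFunctional fun k => f (Pi.single k 1) := by
  ext p
  rw [dotFunctional_apply]
  conv_lhs => rw [pi_eq_sum_univ' p]
  simp [map_sum, mul_comm]

end Polytope

/-! ### Edges and tight exchanges -/

/-- An exchange that is tight relative to `w` yields an edge. -/
lemma isEdgeBetween_of_swap {D : Fin n → Prop} (hD : IsCut w D) {u v : Perm (Fin n)}
    (hu : u ∈ bruhatInterval 1 w) (hv : v ∈ bruhatInterval 1 w) {i l : Fin n} (hil : i < l)
    (huv : v = swap i l * u) (hfix : ∀ j, i < j → j < l → u.symm j = w.symm j) :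
    IsEdgeBetween (bruhatIntervalPolytope 1 w) (permPoint u) (permPoint v) := by
  have hx := (mem_bruhatInterval_iff hD).1 hu
  have hy := (mem_bruhatInterval_iff hD).1 hv
  have hne : u ≠ v := by
    rintro rfl
    exact hil.ne (swap_eq_one_iff.1 (mul_eq_right.1 huv.symm))
  refine ⟨permPoint_mem_extremePoints hu, permPoint_mem_extremePoints hv,
    permPoint_injective.ne hne, ?_⟩
  obtain ⟨x, rfl⟩ : ∃ x, u = x * w := ⟨u * w⁻¹, by simp⟩
  obtain ⟨a₀, rfl⟩ := x.surjective i
  obtain ⟨b₀, rfl⟩ := x.surjective l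
  have hvx : v = x * swap a₀ b₀ * w := by rw [huv, mul_swap_eq_swap_mul, mul_assoc]
  rw [mul_inv_cancel_right] at hx
  rw [hvx, mul_inv_cancel_right] at hy
  have hab : a₀ ≠ b₀ := by rintro rfl; exact hil.false
  -- The exchange is allowed because its result, `v`, lies on the board.
  have htight : Tight (fun b => D (w.symm b)) x a₀ b₀ := by
    refine ⟨⟨hil, ?_, ?_⟩, fun j h1 h2 => ?_⟩
    · simpa using (hy a₀).1
    · simpa using (hy b₀).2
    · have : (x * w) (w.symm j) = j := by rw [← hfix j h1 h2, apply_symm_apply]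
      simpa using this
  obtain ⟨c, hc₀, hc⟩ := htight.exists_functional
  have hcle : ∀ a b, Tight (fun b => D (w.symm b)) x a b → c a ≤ c b := by
    intro a b h
    rcases hc a b h with h | ⟨rfl, rfl⟩
    exacts [h.le, hc₀.le]
  have hval : ∀ z, dotFunctional (fun k => c (w k)) (permPoint z) =
      ∑ b, c b * ((((z * w⁻¹) b : Fin n) : ℕ) : ℝ) + ∑ k, c (w k) := by
    intro z
    simpa using dotFunctional_permPoint (fun k => c (w k)) w z
  have hvu : dotFunctional (fun k => c (w k)) (permPoint v) =
      dotFunctional (fun k => c (w k)) (permPoint (x * w)) := by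
    rw [hval, hval, hvx, mul_inv_cancel_right, mul_inv_cancel_right, sum_mul_mul_swap x c hab,
      hc₀, sub_self, zero_mul, add_zero]
  refine isExposed_convexHull (dotFunctional fun k => c (w k))
    (M := dotFunctional (fun k => c (w k)) (permPoint (x * w))) (convex_segment _ _) ?_ ?_ ?_
  · exact segment_subset_convexHull (Set.mem_image_of_mem _ hu) (Set.mem_image_of_mem _ hv)
  · exact (convex_hyperplane (dotFunctional fun k => c (w k)).toLinearMap.isLinear _).segment_subset
      rfl hvu
  · rintro _ ⟨z, hz, rfl⟩
    have hz := (mem_bruhatInterval_iff hD).1 hz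
    rw [hval, hval, mul_inv_cancel_right]
    obtain ⟨h1, -⟩ := sum_mul_le_of_tight hx hz hcle
    rcases h1.lt_or_eq with h | h
    · exact Or.inl (by linarith)
    right
    rcases eq_or_eq_mul_swap_of_sum_mul_eq hx hz hc₀ hc h with h | h <;>
      rw [mul_inv_eq_iff_eq_mul] at h
    · rw [h]; exact left_mem_segment ℝ _ _
    · rw [h, ← hvx]; exact right_mem_segment ℝ _ _

/-- Every edge comes from an exchange that is tight relative to `w`. -/
lemma IsEdgeBetween.exists_tight {D : Fin n → Prop} (hD : IsCut w D) {u v : Perm (Fin n)}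
    (hu : u ∈ bruhatInterval 1 w) (hv : v ∈ bruhatInterval 1 w)
    (h : IsEdgeBetween (bruhatIntervalPolytope 1 w) (permPoint u) (permPoint v)) :
    ∃ a b, Tight (fun b => D (w.symm b)) (u * w⁻¹) a b ∧ v = u * w⁻¹ * swap a b * w := by
  obtain ⟨-, -, hne, hexp⟩ := h
  obtain ⟨f, hf⟩ := hexp ⟨_, left_mem_segment ℝ _ _⟩
  have hx := (mem_bruhatInterval_iff hD).1 hu
  have hy := (mem_bruhatInterval_iff hD).1 hv
  have hmemP : ∀ z ∈ bruhatInterval 1 w, permPoint z ∈ bruhatIntervalPolytope 1 w :=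
    fun z hz => subset_convexHull ℝ _ (Set.mem_image_of_mem _ hz)
  have hU := hf ▸ left_mem_segment ℝ (permPoint u) (permPoint v)
  have hV := hf ▸ right_mem_segment ℝ (permPoint u) (permPoint v)
  have hUV : f (permPoint v) = f (permPoint u) := le_antisymm (hU.2 _ hV.1) (hV.2 _ hU.1)
  obtain ⟨d, rfl⟩ : ∃ d, f = dotFunctional d := ⟨_, eq_dotFunctional f⟩
  -- If `v` is not a tight neighbour of `u`, every tight exchange leaves the segment, whose only
  -- permutation points are its ends. The functional then drops strictly along each, so `u` is its
  -- only maximizer, although `v` is one too.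
  by_contra! hno
  refine hne (congrArg permPoint (mul_right_cancel (b := w⁻¹) ?_)).symm
  refine eq_of_sum_mul_eq (c := fun b => d (w.symm b)) hx hy (fun a b hab => ?_) ?_
  · have hab' : a ≠ b := by rintro rfl; exact hab.1.1.false
    have hz : u * w⁻¹ * swap a b * w ∈ bruhatInterval 1 w := by
      rw [mem_bruhatInterval_iff hD, mul_inv_cancel_right]
      exact hab.1.mul_swap_mem hx
    have hlt : dotFunctional d (permPoint (u * w⁻¹ * swap a b * w)) <
        dotFunctional d (permPoint u) := by
      by_contra! hle
      have hseg : permPoint (u * w⁻¹ * swap a b * w) ∈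
          segment ℝ (permPoint u) (permPoint v) := by
        rw [hf]
        exact ⟨hmemP _ hz, fun y hy => (hU.2 y hy).trans hle⟩
      rcases eq_or_eq_of_permPoint_mem_segment hseg with h | h
      · rw [← eq_mul_inv_iff_mul_eq, mul_eq_left, swap_eq_one_iff] at h
        exact hab' h
      · exact hno a b hab h.symm
    rw [dotFunctional_permPoint d w, dotFunctional_permPoint d w, mul_inv_cancel_right,
      sum_mul_mul_swap _ (fun b => d (w.symm b)) hab'] at hlt
    have hpos : (0 : ℝ) < (((u * w⁻¹) b : ℕ) : ℝ) - (((u * w⁻¹) a : ℕ) : ℝ) :=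
      sub_pos.2 (Nat.cast_lt.2 hab.1.1)
    by_contra! hle
    have := mul_nonneg (sub_nonneg.2 hle) hpos.le
    linarith
  · rw [dotFunctional_permPoint d w, dotFunctional_permPoint d w] at hUV
    exact add_right_cancel hUV

end BruhatPolytope

theorem mainTheorem4 (n : ℕ) (w : Equiv.Perm (Fin n))
    (hw : BruhatPolytope.IsGrassmannian w)
    (u v : Equiv.Perm (Fin n))
    (hu : u ∈ BruhatPolytope.bruhatInterval 1 w)
    (hv : v ∈ BruhatPolytope.bruhatInterval 1 w) :
    BruhatPolytope.IsEdgeBetween (BruhatPolytope.bruhatIntervalPolytope 1 w)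
        (BruhatPolytope.permPoint u) (BruhatPolytope.permPoint v) ↔
      ∃ i l : Fin n, i < l ∧ v = Equiv.swap i l * u ∧
        ∀ j : Fin n, i < j → j < l →
          u.symm j = w.symm j ∧ v.symm j = w.symm j := by
  obtain ⟨D, hD⟩ := hw.exists_isCut
  constructor
  · intro h
    obtain ⟨a, b, ⟨⟨hlt, -⟩, hfix⟩, hvu⟩ := h.exists_tight hD hu hv
    rw [Equiv.mul_swap_eq_swap_mul, mul_assoc, inv_mul_cancel_right] at hvu
    refine ⟨_, _, hlt, hvu, fun j h1 h2 => ?_⟩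
    have huj : u (w.symm j) = j := hfix j h1 h2
    refine ⟨(Equiv.symm_apply_eq u).2 huj.symm, (Equiv.symm_apply_eq v).2 ?_⟩
    rw [hvu, Equiv.Perm.mul_apply, huj, Equiv.swap_apply_of_ne_of_ne h1.ne' h2.ne]
  · rintro ⟨i, l, hil, hvu, hfix⟩
    exact BruhatPolytope.isEdgeBetween_of_swap hD hu hv hil hvu fun j h1 h2 => (hfix j h1 h2).1
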